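/- Fix $q\in\mathbb{N}$. For $k\in\{0,\dots,q\}$ and $x\in\mathbb{F}_2^q$ (first entry most significant) let $\mathbf{S}^{q-k}x=(0,\dots,0,x_1,\dots,x_k)^T\in\mathbb{F}_2^q$. The ergodic layered erasure one-sided interference channel has two transmitters with inputs $X_{1},X_{2}\in\mathbb{F}_2^q$ and a stationary ergodic state process $(N_{11}(t),N_{22}(t),N_{21}(t))_{t\ge 0}$ with values in $\{0,\dots,q\}^3$ (the three components may be dependent), independent of the messages. Its outputs at time $t$ are $$Y_1(t)=\mathbf{S}^{q-N_{11}(t)}X_1(t),\qquad Y_2(t)=\mathbf{S}^{q-N_{21}(t)}X_1(t)\oplus \mathbf{S}^{q-N_{22}(t)}X_2(t).$$ A code of blocklength $n$ consists of encoders that map message $W_k\in\{1,\dots,M_k\}$ to $X_k^n$ without any knowledge of the states, and of decoders that estimate $W_k$ from $Y_k^n$ and the whole block of $n$ states, $k=1,2$. Its error probability is the probability that at least one of the two decoders errs when $W_1,W_2$ are independent and uniformly distributed. A pair $(R_1,R_2)$ of nonnegative rates (in bits per channel use) is achievable if there are codes with $M_k=\lceil 2^{nR_k}\rceil$, $n=0,1,2,\dots$,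 whose error probability tends to $0$ as $n\to\infty$; the capacity region is the closure of the set of achievable pairs. Theorem. Every $(R_1,R_2)$ in the capacity region (in particular, every achievable pair) satisfies $$R_1\le\mathbb{E}[N_{11}],\qquad R_2\le\mathbb{E}[N_{22}],\qquad R_1+R_2\le\mathbb{E}\big[\max(N_{11},N_{22},N_{21},N_{11}+N_{22}-N_{21})\big],$$ where $(N_{11},N_{22},N_{21})$ has the stationary law of the states. -/

import Mathlib

open MeasureTheory Filter Topology

namespace LayeredErasure

/-- A channel symbol: a vector of `q` bits, entry `0` being the most significant bit. -/
abbrev Symbol (q : ℕ) : Type := Fin q → ZMod 2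

/-- The `q × q` matrix over `𝔽₂` that shifts a column vector down by `k` places; its only nonzero
entries are the ones at the positions `(k + j, j)`. -/
def shiftMatrix (q k : ℕ) : Matrix (Fin q) (Fin q) (ZMod 2) :=
  Matrix.of fun i j => if (i : ℕ) = k + (j : ℕ) then 1 else 0

/-- What a link in state `n` delivers: the `n` most significant bits of `x`, moved to the `n` least
significant positions, preceded by zeros. -/
def linkOutput (q n : ℕ) (x : Symbol q) : Symbol q :=
  (shiftMatrix q (q - n)).mulVec x

/-- The signal at a receiver whose links from transmitters `1` and `2` are in states `a` and `b`
(addition in `𝔽₂` is XOR). -/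
def received (q a b : ℕ) (x₁ x₂ : Symbol q) : Symbol q :=
  linkOutput q a x₁ + linkOutput q b x₂

/-- The state of the one-sided channel in one channel use: the triple `(N₁₁, N₂₂, N₂₁)`, each
entry in `{0, …, q}`. The remaining link state `N₁₂` is identically zero. -/
abbrev State (q : ℕ) : Type := Fin (q + 1) × Fin (q + 1) × Fin (q + 1)

/-- Direct link, from transmitter `1` to receiver `1`. -/
def State.n11 {q : ℕ} (s : State q) : ℕ := s.1

/-- Direct link, from transmitter `2` to receiver `2`. -/
def State.n22 {q : ℕ} (s : State q) : ℕ := s.2.1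

/-- Cross link, from transmitter `1` to receiver `2`. -/
def State.n21 {q : ℕ} (s : State q) : ℕ := s.2.2

/-- The signal at receiver `1`, which sees no interference (`N₁₂ = 0`). -/
def output₁ {q : ℕ} (s : State q) (x₁ x₂ : Symbol q) : Symbol q :=
  received q s.n11 0 x₁ x₂

/-- The signal at receiver `2`. -/
def output₂ {q : ℕ} (s : State q) (x₁ x₂ : Symbol q) : Symbol q :=
  received q s.n21 s.n22 x₁ x₂

/-- A code of blocklength `n` with `M₁` and `M₂` messages. The encoders see their own message only
(no channel state information at the transmitters); each decoder sees its received block and the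
whole block of channel states (perfect channel state information at the receivers). -/
structure Code (q n M₁ M₂ : ℕ) where
  enc₁ : Fin M₁ → Fin n → Symbol q
  enc₂ : Fin M₂ → Fin n → Symbol q
  dec₁ : (Fin n → Symbol q) → (Fin n → State q) → Fin M₁
  dec₂ : (Fin n → Symbol q) → (Fin n → State q) → Fin M₂

namespace Code

variable {q n M₁ M₂ : ℕ}

/-- With messages `w₁`, `w₂` and state block `s`, at least one receiver decodes its own message
wrongly. -/
def Errs (C : Code q n M₁ M₂) (w₁ : Fin M₁) (w₂ : Fin M₂) (s : Fin n → State q) : Prop :=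
  C.dec₁ (fun t => output₁ (s t) (C.enc₁ w₁ t) (C.enc₂ w₂ t)) s ≠ w₁ ∨
    C.dec₂ (fun t => output₂ (s t) (C.enc₁ w₁ t) (C.enc₂ w₂ t)) s ≠ w₂

/-- Average probability of error over the states `N 0, …, N (n - 1)`, for messages that are
independent, uniformly distributed, and independent of the states. -/
noncomputable def errorProb {Ω : Type*} [MeasurableSpace Ω] (μ : Measure Ω)
    (N : ℕ → Ω → State q) (C : Code q n M₁ M₂) : ℝ :=
  (∑ w₁ : Fin M₁, ∑ w₂ : Fin M₂, μ.real {ω | C.Errs w₁ w₂ (fun t => N t ω)}) /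
    ((M₁ : ℝ) * (M₂ : ℝ))

end Code

/-- The number `⌈2 ^ (n R)⌉` of messages of a code of rate `R` and blocklength `n`. -/
noncomputable def numMessages (n : ℕ) (R : ℝ) : ℕ := ⌈(2 : ℝ) ^ ((n : ℝ) * R)⌉₊

/-- The pair of rates `R`, in bits per channel use, is achievable: there are
`(⌈2 ^ (n R₁)⌉, ⌈2 ^ (n R₂)⌉, n)` codes, one for each `n`, whose error probability tends to `0`. -/
def Achievable {Ω : Type*} [MeasurableSpace Ω] (q : ℕ) (μ : Measure Ω)
    (N : ℕ → Ω → State q) (R : ℝ × ℝ) : Prop :=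
  0 ≤ R.1 ∧ 0 ≤ R.2 ∧
    ∃ C : (n : ℕ) → Code q n (numMessages n R.1) (numMessages n R.2),
      Tendsto (fun n => (C n).errorProb μ N) atTop (𝓝 0)

/-- The capacity region: the closure of the set of achievable pairs. -/
def capacityRegion {Ω : Type*} [MeasurableSpace Ω] (q : ℕ) (μ : Measure Ω)
    (N : ℕ → Ω → State q) : Set (ℝ × ℝ) :=
  closure {R | Achievable q μ N R}

/-- The left shift on sequences. -/
def shift {α : Type*} (s : ℕ → α) : ℕ → α := fun t => s (t + 1)

/-- The process `N` is stationary and ergodic: its law on sequence space is invariant under the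
shift, and shift-invariant events have probability zero or one. -/
def StationaryErgodic {Ω α : Type*} [MeasurableSpace Ω] [MeasurableSpace α] (μ : Measure Ω)
    (N : ℕ → Ω → α) : Prop :=
  (∀ t, Measurable (N t)) ∧ Ergodic shift (μ.map fun ω t => N t ω)

end LayeredErasure

/-!
The converse is a counting argument, carried out for each state block separately, followed by a
Markov-type estimate.

Fix a code and a block of states `s`. The channel is then deterministic, and the message pairs
decoded correctly by both receivers can be described by few bits:

* given `w₂`, the `N₁₁` top bits of each `X₁` give `Y₁`, hence `w₁`;
* given `w₁`, the `N₂₂` top bits of each `X₂` give `Y₂`, hence `w₂`;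
* the `max N₂₁ N₂₂` possibly nonzero bits of each `Y₂` give `w₂`, hence `X₂`; cancelling it leaves
  the `N₂₁` top bits of `X₁`, and with `N₁₁ - N₂₁` further bits of `X₁` this gives `Y₁`, hence `w₁`.

So in each of the three cases (`card_correct_le_left`, `card_correct_le_right`,
`card_correct_le_sum`) the fraction of correctly decoded pairs is at most `2 ^ (∑ F (s t) - n r)`,
where `r` is the rate, or sum of rates, to be bounded and `F` counts the bits per channel use. If
the error probability tends to zero, `∑ F (N t) ≥ n (r - δ)` must therefore hold with probability
tending to one. By stationarity the expectation of the left side is `n 𝔼[F (N 0)]`, whence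
`r ≤ 𝔼[F (N 0)]` (`rate_le_integral`). No ergodic theorem is needed, since only an expectation has
to be bounded from below. The bounds define a closed set, so they pass to the closure.
-/

namespace LayeredErasure

/-! ### The deterministic link -/

section Link

variable {q : ℕ}

lemma linkOutput_apply {n : ℕ} (hn : n ≤ q) (x : Symbol q) (i : Fin q) :
    linkOutput q n x i = if q ≤ i + n then x ⟨i + n - q, by omega⟩ else 0 := by
  simp only [linkOutput, shiftMatrix, Matrix.mulVec, dotProduct, Matrix.of_apply, ite_mul, one_mul,
    zero_mul]
  split_ifs with h
  · rw [Finset.sum_eq_single ⟨i + n - q, by omega⟩]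
    · rw [if_pos]
      simp only
      omega
    · intro j _ hj
      rw [if_neg]
      intro h'
      apply hj
      ext
      simp only
      omega
    · simp
  · apply Finset.sum_eq_zero
    intro j _
    rw [if_neg]
    omega

lemma linkOutput_eq_iff {n : ℕ} (hn : n ≤ q) (x y : Symbol q) :
    linkOutput q n x = linkOutput q n y ↔ ∀ j : Fin q, (j : ℕ) < n → x j = y j := by
  constructor
  · intro h j hj
    have := congrFun h ⟨j + q - n, by omega⟩
    rw [linkOutput_apply hn, linkOutput_apply hn, if_pos (by simp only; omega),
      if_pos (by simp only; omega)] at this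
    convert this using 2 <;> (ext; simp only; omega)
  · intro h
    ext i
    rw [linkOutput_apply hn, linkOutput_apply hn]
    split_ifs with hi
    · apply h
      simp only
      omega
    · rfl

lemma linkOutput_eq_zero {n : ℕ} (hn : n ≤ q) (x : Symbol q) {i : Fin q} (hi : (i : ℕ) + n < q) :
    linkOutput q n x i = 0 := by
  rw [linkOutput_apply hn, if_neg (by omega)]

lemma received_eq_zero {a b : ℕ} (ha : a ≤ q) (hb : b ≤ q) (x₁ x₂ : Symbol q) {i : Fin q}
    (hi : (i : ℕ) + max a b < q) : received q a b x₁ x₂ i = 0 := by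
  rw [received, Pi.add_apply, linkOutput_eq_zero ha _ (by omega),
    linkOutput_eq_zero hb _ (by omega), add_zero]

lemma State.n11_le (s : State q) : s.n11 ≤ q := Nat.lt_succ_iff.mp s.1.isLt

lemma State.n22_le (s : State q) : s.n22 ≤ q := Nat.lt_succ_iff.mp s.2.1.isLt

lemma State.n21_le (s : State q) : s.n21 ≤ q := Nat.lt_succ_iff.mp s.2.2.isLt

/-- Receiver `1` sees only the `N₁₁` top bits of `X₁`. -/
lemma output₁_congr (s : State q) {x₁ y₁ : Symbol q} (x₂ y₂ : Symbol q)
    (h : ∀ j : Fin q, (j : ℕ) < s.n11 → x₁ j = y₁ j) : output₁ s x₁ x₂ = output₁ s y₁ y₂ := by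
  rw [output₁, output₁, received, received, (linkOutput_eq_iff s.n11_le _ _).2 h,
    (linkOutput_eq_iff (Nat.zero_le q) x₂ y₂).2 (by simp)]

end Link

/-! ### Counting the message pairs that are decoded correctly -/

section Counting

/-- The bits `k, k + 1, …, k + m - 1` of a symbol. Positions beyond the end are read as zero. -/
def bits {q : ℕ} (k m : ℕ) (x : Symbol q) (i : Fin m) : ZMod 2 :=
  if h : k + (i : ℕ) < q then x ⟨k + i, h⟩ else 0

lemma eq_of_bits_eq {q k m : ℕ} {x y : Symbol q} (h : bits k m x = bits k m y) (j : Fin q)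
    (hk : k ≤ j) (hm : (j : ℕ) < k + m) : x j = y j := by
  have := congrFun h ⟨j - k, by omega⟩
  have hj : k + ((j : ℕ) - k) = j := by omega
  simpa [bits, hj] using this

/-- A finite set whose elements are determined by a label and, for each `t`, a family of bits
indexed by `ι t`, is no larger than the number of such data. -/
lemma card_le_of_injOn_bits {α κ T : Type*} [Fintype κ] [Fintype T] {ι : T → Type*}
    [∀ t, Fintype (ι t)] (S : Finset α) (l : α → κ) (b : α → (t : T) → ι t → ZMod 2)
    (h : ∀ x ∈ S, ∀ y ∈ S, l x = l y → b x = b y → x = y) :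
    S.card ≤ Fintype.card κ * 2 ^ ∑ t, Fintype.card (ι t) := by
  classical
  have := Finset.card_le_card_of_injOn (s := S) (t := Finset.univ) (fun x => (l x, b x))
    (fun _ _ => Finset.mem_coe.2 (Finset.mem_univ _)) (fun x hx y hy hxy =>
      h x hx y hy (congrArg Prod.fst hxy) (congrArg Prod.snd hxy))
  simpa [Finset.card_univ, Fintype.card_prod, Fintype.card_pi, ZMod.card,
    Finset.prod_pow_eq_pow_sum] using this

variable {q n M₁ M₂ : ℕ} (C : Code q n M₁ M₂) (s : Fin n → State q)

open scoped Classical in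
/-- The message pairs that both receivers decode correctly when the state block is `s`. -/
noncomputable def Code.correct : Finset (Fin M₁ × Fin M₂) :=
  Finset.univ.filter fun w => ¬ C.Errs w.1 w.2 s

variable {C s}

lemma Code.dec₁_of_mem_correct {w : Fin M₁ × Fin M₂} (hw : w ∈ C.correct s) :
    C.dec₁ (fun t => output₁ (s t) (C.enc₁ w.1 t) (C.enc₂ w.2 t)) s = w.1 := by
  simp only [Code.correct, Code.Errs, Finset.mem_filter, not_or, not_not] at hw
  exact hw.2.1

lemma Code.dec₂_of_mem_correct {w : Fin M₁ × Fin M₂} (hw : w ∈ C.correct s) :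
    C.dec₂ (fun t => output₂ (s t) (C.enc₁ w.1 t) (C.enc₂ w.2 t)) s = w.2 := by
  simp only [Code.correct, Code.Errs, Finset.mem_filter, not_or, not_not] at hw
  exact hw.2.2

variable (C s)

lemma Code.card_correct_le_left : (C.correct s).card ≤ M₂ * 2 ^ ∑ t, (s t).n11 := by
  have := card_le_of_injOn_bits (C.correct s) Prod.snd
    (fun w t => bits 0 (s t).n11 (C.enc₁ w.1 t)) ?_
  · simpa using this
  · intro w hw v hv h₂ hb
    refine Prod.ext ?_ h₂
    rw [← C.dec₁_of_mem_correct hw, ← C.dec₁_of_mem_correct hv]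
    congr 1
    funext t
    exact output₁_congr _ _ _ fun j hj =>
      eq_of_bits_eq (congrFun hb t) j (Nat.zero_le _) (by omega)

lemma Code.card_correct_le_right : (C.correct s).card ≤ M₁ * 2 ^ ∑ t, (s t).n22 := by
  have := card_le_of_injOn_bits (C.correct s) Prod.fst
    (fun w t => bits 0 (s t).n22 (C.enc₂ w.2 t)) ?_
  · simpa using this
  · intro w hw v hv h₁ hb
    refine Prod.ext h₁ ?_
    rw [← C.dec₂_of_mem_correct hw, ← C.dec₂_of_mem_correct hv]
    congr 1
    funext t
    rw [output₂, output₂, received, received, h₁, (linkOutput_eq_iff (s t).n22_le _ _).2 fun j hj =>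
      eq_of_bits_eq (congrFun hb t) j (Nat.zero_le _) (by omega)]

/-- The number of bits per channel use in the bound on the sum rate: those of `Y₂`, and those of
`Y₁` that receiver `2` does not see. -/
def sumBits {q : ℕ} (s : State q) : ℕ := max s.n21 s.n22 + (s.n11 - s.n21)

lemma cast_sumBits {q : ℕ} (s : State q) :
    (sumBits s : ℝ) =
      max (max (max (s.n11 : ℝ) (s.n22 : ℝ)) (s.n21 : ℝ))
        ((s.n11 : ℝ) + (s.n22 : ℝ) - (s.n21 : ℝ)) := by
  have key : (sumBits s : ℤ) =
      max (max (max (s.n11 : ℤ) (s.n22 : ℤ)) (s.n21 : ℤ))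
        ((s.n11 : ℤ) + (s.n22 : ℤ) - (s.n21 : ℤ)) := by
    rw [sumBits]
    omega
  exact_mod_cast congrArg (Int.cast (R := ℝ)) key

lemma Code.card_correct_le_sum : (C.correct s).card ≤ 2 ^ ∑ t, sumBits (s t) := by
  have := card_le_of_injOn_bits (C.correct s) (fun _ => ())
    (ι := fun t => Fin (max (s t).n21 (s t).n22) ⊕ Fin ((s t).n11 - (s t).n21))
    (fun w t => Sum.elim
      (bits (q - max (s t).n21 (s t).n22) (max (s t).n21 (s t).n22)
        (output₂ (s t) (C.enc₁ w.1 t) (C.enc₂ w.2 t)))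
      (bits (s t).n21 ((s t).n11 - (s t).n21) (C.enc₁ w.1 t))) ?_
  · simpa [sumBits] using this
  · intro w hw v hv _ hb
    have hY (t : Fin n) : output₂ (s t) (C.enc₁ w.1 t) (C.enc₂ w.2 t) =
        output₂ (s t) (C.enc₁ v.1 t) (C.enc₂ v.2 t) := by
      have hbt := congrArg (fun f => f ∘ Sum.inl) (congrFun hb t)
      simp only [Sum.elim_comp_inl] at hbt
      ext i
      by_cases hi : (i : ℕ) + max (s t).n21 (s t).n22 < q
      · rw [output₂, output₂, received_eq_zero (s t).n21_le (s t).n22_le _ _ hi,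
          received_eq_zero (s t).n21_le (s t).n22_le _ _ hi]
      · exact eq_of_bits_eq hbt i (by omega) (by omega)
    have h₂ : w.2 = v.2 := by
      rw [← C.dec₂_of_mem_correct hw, ← C.dec₂_of_mem_correct hv]
      congr 1
      exact funext hY
    refine Prod.ext ?_ h₂
    rw [← C.dec₁_of_mem_correct hw, ← C.dec₁_of_mem_correct hv]
    congr 1
    funext t
    refine output₁_congr _ _ _ fun j hj => ?_
    -- With `X₂` known, the interference can be read off `Y₂`.
    have hX := hY t
    rw [output₂, output₂, received, received, h₂, add_left_inj,
      linkOutput_eq_iff (s t).n21_le] at hX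
    by_cases hj' : (j : ℕ) < (s t).n21
    · exact hX j hj'
    · have hbt := congrArg (fun f => f ∘ Sum.inr) (congrFun hb t)
      simp only [Sum.elim_comp_inr] at hbt
      exact eq_of_bits_eq hbt j (by omega) (by omega)

end Counting

/-! ### From counting to rates -/

section Rates

variable {q : ℕ} {Ω : Type*} [MeasurableSpace Ω] {μ : Measure Ω} {N : ℕ → Ω → State q}

lemma StationaryErgodic.map_eq (hN : StationaryErgodic μ N) (t : ℕ) :
    μ.map (N t) = μ.map (N 0) := by
  have hm : Measurable fun ω t => N t ω := measurable_pi_lambda _ hN.1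
  have hev (t : ℕ) : μ.map (N t) = (μ.map fun ω t => N t ω).map (Function.eval t) := by
    rw [Measure.map_map (measurable_pi_apply t) hm]
    rfl
  induction t with
  | zero => rfl
  | succ t ih =>
    rw [← ih, hev t, hev (t + 1)]
    conv_rhs => rw [← hN.2.toMeasurePreserving.map_eq]
    rw [Measure.map_map (measurable_pi_apply t) hN.2.toMeasurePreserving.measurable]
    rfl

lemma StationaryErgodic.integral_comp (hN : StationaryErgodic μ N) (F : State q → ℝ) (t : ℕ) :
    ∫ ω, F (N t ω) ∂μ = ∫ ω, F (N 0 ω) ∂μ := by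
  rw [← integral_map (hN.1 t).aemeasurable (.of_discrete (f := F)),
    ← integral_map (hN.1 0).aemeasurable (.of_discrete (f := F)), hN.map_eq t]

lemma measurableSet_block (hN : ∀ t, Measurable (N t)) (n : ℕ) (p : (Fin n → State q) → Prop) :
    MeasurableSet {ω | p fun t => N t ω} := by
  have hm : Measurable fun ω => fun t : Fin n => N t ω := measurable_pi_lambda _ fun t => hN t
  exact hm (Set.toFinite {s | p s}).measurableSet

variable [IsProbabilityMeasure μ]

lemma integrable_comp_state {N₀ : Ω → State q} (hN₀ : Measurable N₀) (F : State q → ℝ) :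
    Integrable (fun ω => F (N₀ ω)) μ := by
  have := Measure.isFiniteMeasure_map μ N₀
  exact (Integrable.of_finite (μ := μ.map N₀) (f := F)).comp_measurable hN₀

/-- If, for each state block in some set, at most a fraction `c` of the message pairs is decoded
correctly, then the error probability is at least `1 - c` times the probability of that set. -/
lemma Code.mul_measureReal_le_errorProb {n M₁ M₂ : ℕ} (hN : ∀ t, Measurable (N t)) (h₁ : 0 < M₁)
    (h₂ : 0 < M₂) (C : Code q n M₁ M₂) (p : (Fin n → State q) → Prop) (c : ℝ)
    (hc : ∀ s, p s → ((C.correct s).card : ℝ) ≤ c * (M₁ * M₂)) :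
    (1 - c) * μ.real {ω | p fun t => N t ω} ≤ C.errorProb μ N := by
  classical
  have hM : (0 : ℝ) < M₁ * M₂ := by positivity
  have hE (w : Fin M₁ × Fin M₂) : MeasurableSet {ω | C.Errs w.1 w.2 fun t => N t ω} :=
    measurableSet_block hN n _
  have hP := measurableSet_block hN n p
  rw [Code.errorProb, le_div_iff₀ hM, ← Fintype.sum_prod_type']
  calc (1 - c) * μ.real {ω | p fun t => N t ω} * (M₁ * M₂)
      = ∫ ω, {ω | p fun t => N t ω}.indicator (fun _ => (1 - c) * ((M₁ : ℝ) * M₂)) ω ∂μ := by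
        rw [integral_indicator_const _ hP, smul_eq_mul]
        ring
    _ ≤ ∫ ω, ∑ w : Fin M₁ × Fin M₂,
          {ω | C.Errs w.1 w.2 fun t => N t ω}.indicator (fun _ => (1 : ℝ)) ω ∂μ := by
        refine integral_mono ((integrable_const _).indicator hP)
          (integrable_finsetSum _ fun w _ => (integrable_const _).indicator (hE w)) fun ω => ?_
        by_cases hω : p fun t => N t ω
        · rw [Set.indicator_of_mem (by exact hω)]
          have hcount := Finset.card_filter_add_card_filter_not (s := Finset.univ)
            (fun w : Fin M₁ × Fin M₂ => C.Errs w.1 w.2 fun t => N t ω)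
          have hgood := hc _ hω
          rw [Finset.card_univ, Fintype.card_prod, Fintype.card_fin, Fintype.card_fin] at hcount
          have hcount' := congrArg (Nat.cast (R := ℝ)) hcount
          push_cast at hcount'
          simp only [Set.indicator_apply, Set.mem_ofPred_eq, Finset.sum_boole]
          rw [Code.correct] at hgood
          have heq : ((Finset.univ.filter fun w : Fin M₁ × Fin M₂ =>
              ¬ C.Errs w.1 w.2 fun t => N t ω).card : ℝ) ≤ c * (M₁ * M₂) := by
            convert hgood
          linarith
        · rw [Set.indicator_of_notMem (by exact hω)]
          exact Finset.sum_nonneg fun w _ => Set.indicator_nonneg (fun _ _ => zero_le_one) _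
    _ = ∑ w : Fin M₁ × Fin M₂, μ.real {ω | C.Errs w.1 w.2 fun t => N t ω} := by
        rw [integral_finsetSum _ fun w _ => (integrable_const _).indicator (hE w)]
        refine Finset.sum_congr rfl fun w _ => ?_
        rw [integral_indicator_const _ (hE w), smul_eq_mul, mul_one]

/-- A rate `r` such that the fraction of correctly decoded pairs is at most
`2 ^ (∑ F (s t) - n r)` for each state block `s` cannot exceed `𝔼[F (N 0)]`. -/
lemma rate_le_integral (hN : StationaryErgodic μ N) (F : State q → ℕ) (r : ℝ) {M₁ M₂ : ℕ → ℕ}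
    (h₁ : ∀ n, 0 < M₁ n) (h₂ : ∀ n, 0 < M₂ n) (C : (n : ℕ) → Code q n (M₁ n) (M₂ n))
    (hC : Tendsto (fun n => (C n).errorProb μ N) atTop (𝓝 0))
    (hF : ∀ n s, (((C n).correct s).card : ℝ) * 2 ^ ((n : ℝ) * r) ≤
      M₁ n * M₂ n * 2 ^ ∑ t, F (s t)) :
    r ≤ ∫ ω, (F (N 0 ω) : ℝ) ∂μ := by
  refine le_of_forall_pos_sub_le fun δ hδ => ?_
  let p (n : ℕ) (s : Fin n → State q) : Prop := ((∑ t, F (s t) : ℕ) : ℝ) < n * (r - δ)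
  let P (n : ℕ) : ℝ := μ.real {ω | p n fun t => N t ω}
  have hpow : Tendsto (fun n : ℕ => ((2 : ℝ) ^ (-δ)) ^ n) atTop (𝓝 0) :=
    tendsto_pow_atTop_nhds_zero_of_lt_one (by positivity)
      (Real.rpow_lt_one_of_one_lt_of_neg one_lt_two (by linarith))
  have hle (n : ℕ) : (1 - ((2 : ℝ) ^ (-δ)) ^ n) * P n ≤ (C n).errorProb μ N := by
    refine Code.mul_measureReal_le_errorProb hN.1 (h₁ n) (h₂ n) (C n) (p n) _ fun s hs => ?_
    have hM : (0 : ℝ) ≤ M₁ n * M₂ n := by positivity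
    have h2 : (2 : ℝ) ^ ∑ t, F (s t) ≤ ((2 : ℝ) ^ (-δ)) ^ n * 2 ^ ((n : ℝ) * r) := by
      rw [← Real.rpow_natCast, ← Real.rpow_natCast, ← Real.rpow_mul zero_le_two,
        ← Real.rpow_add two_pos]
      refine Real.rpow_le_rpow_of_exponent_le one_le_two ?_
      have : ((∑ t, F (s t) : ℕ) : ℝ) < n * (r - δ) := hs
      linarith
    have h3 := (hF n s).trans (mul_le_mul_of_nonneg_left h2 hM)
    refine le_of_mul_le_mul_right (h3.trans_eq ?_) (Real.rpow_pos_of_pos two_pos ((n : ℝ) * r))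
    ring
  have hP : Tendsto P atTop (𝓝 0) := by
    have hhalf : ∀ᶠ n : ℕ in atTop, ((2 : ℝ) ^ (-δ)) ^ n < 1 / 2 :=
      hpow.eventually_lt_const (by norm_num)
    refine squeeze_zero' (Eventually.of_forall fun n => measureReal_nonneg) ?_
      (by simpa using hC.const_mul 2)
    filter_upwards [hhalf] with n hn
    have h0 : 0 ≤ P n := measureReal_nonneg
    nlinarith [hle n]
  have hmean : ∀ᶠ n : ℕ in atTop, (r - δ) * (1 - P n) ≤ ∫ ω, (F (N 0 ω) : ℝ) ∂μ := by
    filter_upwards [eventually_gt_atTop 0] with n hn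
    have hn' : (0 : ℝ) < n := by exact_mod_cast hn
    have hmeas := (measurableSet_block hN.1 n (p n)).compl
    have hint (t : Fin n) : Integrable (fun ω => (F (N t ω) : ℝ)) μ :=
      integrable_comp_state (hN.1 t) fun s => (F s : ℝ)
    have h : n * ((r - δ) * (1 - P n)) ≤ n * ∫ ω, (F (N 0 ω) : ℝ) ∂μ :=
      calc n * ((r - δ) * (1 - P n))
          = ∫ ω, {ω | p n fun t => N t ω}ᶜ.indicator (fun _ => n * (r - δ)) ω ∂μ := by
            rw [integral_indicator_const _ hmeas, smul_eq_mul,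
              probReal_compl_eq_one_sub (measurableSet_block hN.1 n (p n))]
            ring
        _ ≤ ∫ ω, ∑ t : Fin n, (F (N t ω) : ℝ) ∂μ := by
            refine integral_mono ((integrable_const _).indicator hmeas)
              (integrable_finsetSum _ fun t _ => hint t) fun ω => ?_
            refine Set.indicator_apply_le' (fun hω => ?_) fun _ => by positivity
            have hω' : ¬ ((∑ t : Fin n, F (N t ω) : ℕ) : ℝ) < n * (r - δ) := hω
            push_cast at hω'
            exact not_lt.1 hω'
        _ = n * ∫ ω, (F (N 0 ω) : ℝ) ∂μ := by
            rw [integral_finsetSum _ fun t _ => hint t,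
              Finset.sum_congr rfl fun (t : Fin n) _ => hN.integral_comp (fun s => (F s : ℝ)) t]
            simp
    exact le_of_mul_le_mul_left h hn'
  have hlim : Tendsto (fun n => (r - δ) * (1 - P n)) atTop (𝓝 (r - δ)) := by
    simpa using (hP.const_sub 1).const_mul (r - δ)
  exact le_of_tendsto hlim hmean

lemma numMessages_pos (n : ℕ) (R : ℝ) : 0 < numMessages n R :=
  Nat.ceil_pos.2 (by positivity)

lemma rpow_le_numMessages (n : ℕ) (R : ℝ) : (2 : ℝ) ^ ((n : ℝ) * R) ≤ numMessages n R :=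
  Nat.le_ceil _

theorem Achievable.le_integral (hN : StationaryErgodic μ N) {R : ℝ × ℝ}
    (hR : Achievable q μ N R) :
    R.1 ≤ ∫ ω, ((N 0 ω).n11 : ℝ) ∂μ ∧
      R.2 ≤ ∫ ω, ((N 0 ω).n22 : ℝ) ∂μ ∧
      R.1 + R.2 ≤ ∫ ω, (sumBits (N 0 ω) : ℝ) ∂μ := by
  obtain ⟨-, -, C, hC⟩ := hR
  have hpos₁ (n : ℕ) := numMessages_pos n R.1
  have hpos₂ (n : ℕ) := numMessages_pos n R.2
  refine ⟨rate_le_integral hN State.n11 R.1 hpos₁ hpos₂ C hC fun n s => ?_,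
    rate_le_integral hN State.n22 R.2 hpos₁ hpos₂ C hC fun n s => ?_,
    rate_le_integral hN sumBits (R.1 + R.2) hpos₁ hpos₂ C hC fun n s => ?_⟩
  · have hcard : (((C n).correct s).card : ℝ) ≤ numMessages n R.2 * 2 ^ ∑ t, (s t).n11 := by
      exact_mod_cast (C n).card_correct_le_left s
    refine (mul_le_mul hcard (rpow_le_numMessages n R.1) (by positivity)
      (by positivity)).trans_eq ?_
    ring
  · have hcard : (((C n).correct s).card : ℝ) ≤ numMessages n R.1 * 2 ^ ∑ t, (s t).n22 := by
      exact_mod_cast (C n).card_correct_le_right s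
    refine (mul_le_mul hcard (rpow_le_numMessages n R.2) (by positivity)
      (by positivity)).trans_eq ?_
    ring
  · have hcard : (((C n).correct s).card : ℝ) ≤ 2 ^ ∑ t, sumBits (s t) := by
      exact_mod_cast (C n).card_correct_le_sum s
    rw [mul_add, Real.rpow_add two_pos]
    refine (mul_le_mul hcard (mul_le_mul (rpow_le_numMessages n R.1) (rpow_le_numMessages n R.2)
      (by positivity) (by positivity)) (by positivity) (by positivity)).trans_eq ?_
    ring

end Rates

end LayeredErasure

theorem mainTheorem2 (q : ℕ) {Ω : Type*} [MeasurableSpace Ω] (μ : Measure Ω)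
    [IsProbabilityMeasure μ] (N : ℕ → Ω → LayeredErasure.State q)
    (hN : LayeredErasure.StationaryErgodic μ N)
    (R : ℝ × ℝ) (hR : R ∈ LayeredErasure.capacityRegion q μ N) :
    R.1 ≤ ∫ ω, ((N 0 ω).n11 : ℝ) ∂μ ∧
      R.2 ≤ ∫ ω, ((N 0 ω).n22 : ℝ) ∂μ ∧
      R.1 + R.2 ≤ ∫ ω, max (max (max ((N 0 ω).n11 : ℝ) ((N 0 ω).n22 : ℝ)) ((N 0 ω).n21 : ℝ))
        (((N 0 ω).n11 : ℝ) + ((N 0 ω).n22 : ℝ) - ((N 0 ω).n21 : ℝ)) ∂μ := by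
  simp only [← LayeredErasure.cast_sumBits]
  have hclosed (c₁ c₂ c₃ : ℝ) :
      IsClosed {R : ℝ × ℝ | R.1 ≤ c₁ ∧ R.2 ≤ c₂ ∧ R.1 + R.2 ≤ c₃} :=
    (isClosed_le continuous_fst continuous_const).inter
      ((isClosed_le continuous_snd continuous_const).inter
        (isClosed_le (continuous_fst.add continuous_snd) continuous_const))
  exact closure_minimal (fun _ h => h.le_integral hN) (hclosed _ _ _) hR
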